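/- **Setting.** For $m\in\mathbb N_0$ and $k\in\mathbb N_0$ let $P_n^{k,m}$ be the Jacobi polynomials for the weight $(1-x)^k(1+x)^m$ on $(-1,1)$, and for $m\in\mathbb Z$ let $$\mathcal Q_n^{k,m}(re^{i\theta})=e^{im\theta}r^{|m|}P_n^{k,|m|}(2r^2-1)$$ be the Zernike polynomials on the closed unit disk $\mathbb D$; for $k=0$ and fixed $m$ they are orthogonal in $L^2(\mathbb D)$. Let $V^{0,m}$ be the space $\ell^1(\mathbb N_0;\mathbb C)$ with norm $\|a\|_1=\sum_n|a_n|$, where $a\in V^{0,m}$ is regarded as the coefficient sequence of $\mathcal M_m[a]=\sum_n a_n\mathcal Q_n^{0,m}$; $\mathcal M_m^{-1}u$ denotes the sequence of coefficients of $u$ with respect to $(\mathcal Q_n^{0,m})_n$, $(\mathcal M_m^{-1}u)_n=\int_{\mathbb D}u\,\overline{\mathcal Q_n^{0,m}}\big/\int_{\mathbb D}|\mathcal Q_n^{0,m}|^2$. On coefficient sequences define * the product $a*b=\mathcal M_{m_1+m_2}^{-1}(\mathcal M_{m_1}[a]\,\mathcal M_{m_2}[b])$ of sequences of wave numbers $m_1$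 and $m_2$; * $R^-$, multiplication by $\bar z$, from wave number $m$ to $m-1$, $R^-a=\mathcal M_{m-1}^{-1}(\bar z\,\mathcal M_m[a])$, and $(R^-)^m$, the $m$-fold composition from wave number $2m$ to $m$; * $(R^+_{0,1})^{-1}$, division by $z$, from wave number $2$ to $1$ (the inverse of multiplication by $z$); * the inverse Dirichlet Laplacian $\triangle_0^{-1}$ at wave number $m\ge 0$, the linear operator given by $$\triangle_0^{-1}\mathcal Q_n^{0,m}=\begin{cases}\dfrac{\mathcal Q_1^{0,m}-\mathcal Q_0^{0,m}}{4(m+1)(m+2)}&n=0,\\[2mm] \dfrac{\mathcal Q_{n+1}^{0,m}}{4(2n+m+1)(2n+m+2)}-\dfrac{\mathcal Q_n^{0,m}}{2(2n+m+2)(2n+m)}+\dfrac{\mathcal Q_{n-1}^{0,m}}{4(2n+m)(2n+m+1)}&n\ge1.\end{cases}$$ For $m\in\mathbb N_0\cup\{-1\}$ and a coefficient sequence $U$ of wave number $|m|$ put $$T_m(U)=\begin{cases}\triangle_0^{-1}(R^-)^m(U*U)&m\in\mathbb N_0,\\ \triangle_0^{-1}(R^+_{0,1})^{-1}(U*U)&m=-1,\end{cases}\qquad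 F_m(U)=U+T_m(U).$$ For $N\in\mathbb N_0$ let $\pi^N$ be the projection keeping the entries with index $n\le N$ and setting the others to $0$, and let $\pi^\infty=I-\pi^N$. **Lemma.** Let $m\in\mathbb N_0\cup\{-1\}$ and $N\in\mathbb N_0$. Let $U_0\in V^{0,|m|}$ satisfy $U_0=\pi^NU_0$, let $A^N$ be a bounded linear operator on $V^{0,|m|}$ with $A^N=\pi^NA^N\pi^N$, and put $A=A^N+\pi^\infty$. Then $T_m(U_0)$ and $F_m(U_0)$ belong to $V^{0,|m|}$, and $$\|AF_m(U_0)\|_1=\begin{cases}\|A^N(U_0+\pi^N\triangle_0^{-1}(R^-)^m(U_0*U_0))\|_1+\|(\pi^{2N+m+1}-\pi^N)\triangle_0^{-1}(R^-)^m(U_0*U_0)\|_1&m\in\mathbb N_0,\\ \|A^N(U_0+\pi^N\triangle_0^{-1}(R^+_{0,1})^{-1}(U_0*U_0))\|_1+\|(\pi^{2N+1}-\pi^N)\triangle_0^{-1}(R^+_{0,1})^{-1}(U_0*U_0)\|_1&m=-1.\end{cases}$$ In particular, if a real number $Y_0$ is greater than or equal to the right-hand side, then $\|AF_m(U_0)\|_1\le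 Y_0$. -/

import Mathlib

open MeasureTheory Polynomial

open scoped ComplexConjugate ENNReal

namespace ZernikeDisk

noncomputable section

/-! ### Jacobi and Zernike polynomials -/

/-- The Jacobi polynomials `P_n^{k,m}` (orthogonal for the weight `(1-x)^k (1+x)^m` on `(-1,1)`),
by the three-term recurrence `P_{n+1} = (α_n x - β_n) P_n - γ_n P_{n-1}`, `P_0 = 1`, `P_{-1} = 0`.
The first clause for `P_1` is the recurrence at `n = 0`; there `β_0 = (m-k)/2`, which is the
simplified form of the general expression (the latter reads `0/0` for `k = m = 0`). -/
def jacobi (k m : ℕ) : ℕ → ℝ[X]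
  | 0 => 1
  | 1 => C (((k : ℝ) + m + 2) / 2) * X - C (((m : ℝ) - k) / 2)
  | (j + 2) =>
    let n : ℝ := (j : ℝ) + 1
    let α : ℝ := (2 * n + k + m + 1) * (2 * n + k + m + 2) / (2 * (n + 1) * (n + k + m + 1))
    let β : ℝ := ((m : ℝ) ^ 2 - (k : ℝ) ^ 2) * (2 * n + k + m + 1)
      / (2 * (n + 1) * (n + k + m + 1) * (2 * n + k + m))
    let γ : ℝ := (n + k) * (n + m) * (2 * n + k + m + 2)
      / ((n + 1) * (n + k + m + 1) * (2 * n + k + m))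
    (C α * X - C β) * jacobi k m (j + 1) - C γ * jacobi k m j

/-- The radial Zernike polynomial `Q_n^{k,m}(r) = r^{|m|} P_n^{k,|m|}(2 r^2 - 1)`. -/
def radialZernike (k : ℕ) (m : ℤ) (n : ℕ) (r : ℝ) : ℝ :=
  r ^ m.natAbs * (jacobi k m.natAbs n).eval (2 * r ^ 2 - 1)

/-- The Zernike polynomial `𝒬_n^{k,m}(r e^{iθ}) = e^{imθ} Q_n^{k,m}(r)` as a function of
`z = r e^{iθ}`. -/
def zernike (k : ℕ) (m : ℤ) (n : ℕ) (z : ℂ) : ℂ :=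
  Complex.exp (Complex.I * m * z.arg) * (radialZernike k m n ‖z‖ : ℝ)

/-! ### Coefficients of wave number `m` and functions on the disk

A sequence `a : ℕ → ℂ` stands for the Zernike coefficients (with `k = 0`) of a function of a single
wave number `m`; the wave number is passed to each operation. -/

/-- `ℳ[a](z) = ∑ a_n 𝒬_n^{0,m}(z)`. -/
def transform (m : ℤ) (a : ℕ → ℂ) (z : ℂ) : ℂ :=
  ∑' n, a n * zernike 0 m n z

/-- `ℳ⁻¹`: the coefficients of wave number `m` of a function on the closed unit disk, i.e. its
coordinates with respect to the system `𝒬_n^{0,m}`, which is orthogonal in `L²` of the disk. -/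
def coeffs (m : ℤ) (u : ℂ → ℂ) (n : ℕ) : ℂ :=
  (∫ z in Metric.closedBall (0 : ℂ) 1, u z * conj (zernike 0 m n z)) /
    ((∫ z in Metric.closedBall (0 : ℂ) 1, ‖zernike 0 m n z‖ ^ 2 : ℝ) : ℂ)

/-- The discrete convolution `V^{0,m₁} × V^{0,m₂} → V^{0,m₁+m₂}`,
`a * b = ℳ⁻¹(ℳ[a] · ℳ[b])`. -/
def conv (m₁ m₂ : ℤ) (a b : ℕ → ℂ) : ℕ → ℂ :=
  coeffs (m₁ + m₂) (fun z => transform m₁ a z * transform m₂ b z)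

/-- `R⁻` on `V^{0,m} → V^{0,m-1}`: multiplication by `z̄`. -/
def rMinus (m : ℤ) (a : ℕ → ℂ) : ℕ → ℂ :=
  coeffs (m - 1) (fun z => conj z * transform m a z)

/-- `(R⁻)^j` on `V^{0,m}`, the composition `V^{0,m} → V^{0,m-1} → ⋯ → V^{0,m-j}`. -/
def rMinusPow : ℕ → ℤ → (ℕ → ℂ) → (ℕ → ℂ)
  | 0, _, a => a
  | j + 1, m, a => rMinusPow j (m - 1) (rMinus m a)

/-- `(R⁺_{0,1})⁻¹ : V^{0,2} → V^{0,1}`. As `R⁺_{0,1} : V^{0,1} → V^{0,2}` is multiplication by `z`,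
this is division by `z` (the point `z = 0` is a null set). -/
def rPlusInv (a : ℕ → ℂ) : ℕ → ℂ :=
  coeffs 1 (fun z => z⁻¹ * transform 2 a z)

/-- The coefficient sequence of `Δ₀⁻¹ 𝒬_n^{0,m}`, the solution `v` of `Δ v = 𝒬_n^{0,m}` in the unit
disk with `v = 0` on the unit circle (`m ≥ 0`). -/
def invLaplacianBasis (m : ℕ) : ℕ → ℕ → ℂ
  | 0 =>
    (1 / (4 * ((m : ℂ) + 1) * (m + 2))) • Pi.single 1 (1 : ℂ)
      - (1 / (4 * ((m : ℂ) + 1) * (m + 2))) • Pi.single 0 (1 : ℂ)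
  | (j + 1) =>
    let n : ℂ := (j : ℂ) + 1
    (1 / (4 * (2 * n + m + 1) * (2 * n + m + 2))) • Pi.single (j + 2) (1 : ℂ)
      - (1 / (2 * (2 * n + m + 2) * (2 * n + m))) • Pi.single (j + 1) (1 : ℂ)
      + (1 / (4 * (2 * n + m) * (2 * n + m + 1))) • Pi.single j (1 : ℂ)

/-- The inverse Dirichlet Laplacian `Δ₀⁻¹` on `V^{0,m}`: `a ↦ ∑_n a_n Δ₀⁻¹ 𝒬_n^{0,m}`. Its matrix is
tridiagonal, so the entry `i` only receives contributions from `n ≤ i + 1`. -/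
def invLaplacian (m : ℕ) (a : ℕ → ℂ) (i : ℕ) : ℂ :=
  ∑ n ∈ Finset.range (i + 2), a n * invLaplacianBasis m n i

/-- The nonlinear part of `F_m`, with `G(U) = U * U ∈ V^{0,2|m|}`:
`Δ₀⁻¹ (R⁺_{0,1})⁻¹ G(U)` for `m = -1` and `Δ₀⁻¹ (R⁻)^m G(U)` for `m ≥ 0`. -/
def nonlinearPart (m : ℤ) (U : ℕ → ℂ) : ℕ → ℂ :=
  if m = -1 then
    invLaplacian 1 (rPlusInv (conv 1 1 U U))
  else
    invLaplacian m.toNat (rMinusPow m.toNat (m + m) (conv m m U U))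

/-- `F_m(U) = U + Δ₀⁻¹ (R⁺_{0,1})⁻¹ G(U)` for `m = -1`, and
`F_m(U) = U + Δ₀⁻¹ (R⁻)^m G(U)` for `m ≥ 0`, as a coefficient sequence. -/
def zeroMap (m : ℤ) (U : ℕ → ℂ) : ℕ → ℂ :=
  U + nonlinearPart m U

/-! ### The space `V^{0,|m|}`, truncations, and the approximate inverse -/

/-- The space `V^{0,|m|}` with trivial weights, i.e. `ℓ¹(ℕ, ℂ)` with its norm `‖·‖₁`. -/
abbrev V : Type := lp (fun _ : ℕ => ℂ) 1

theorem norm_trunc_le (N : ℕ) (v : ℕ → ℂ) (n : ℕ) :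
    ‖(if n ≤ N then v n else 0)‖ ≤ ‖v n‖ := by
  split_ifs <;> simp

theorem memlp_trunc (N : ℕ) (v : V) :
    Memℓp (fun n => if n ≤ N then (v : ℕ → ℂ) n else 0) 1 :=
  (lp.memℓp v).mono' (norm_trunc_le N v)

/-- The truncation `π^N`, which keeps the entries `0, …, N` and sets the others to `0`. -/
def proj (N : ℕ) : V →L[ℂ] V :=
  LinearMap.mkContinuous
    { toFun := fun v => ⟨fun n => if n ≤ N then (v : ℕ → ℂ) n else 0, memlp_trunc N v⟩
      map_add' := by
        intro v w
        ext n
        change (if n ≤ N then (v : ℕ → ℂ) n + (w : ℕ → ℂ) n else 0) =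
          (if n ≤ N then (v : ℕ → ℂ) n else 0) + (if n ≤ N then (w : ℕ → ℂ) n else 0)
        by_cases h : n ≤ N <;> simp [h]
      map_smul' := by
        intro c v
        ext n
        by_cases h : n ≤ N <;> simp [h] }
    1 (by
      intro v
      rw [one_mul]
      exact lp.norm_mono (by norm_num) (norm_trunc_le N v))

/-- The complementary projection `π^∞ = I - π^N`. -/
def projTail (N : ℕ) : V →L[ℂ] V :=
  ContinuousLinearMap.id ℂ V - proj N

/-- The approximate inverse `A = A^N + π^∞`. -/
def approxInverse (N : ℕ) (AN : V →L[ℂ] V) : V →L[ℂ] V :=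
  AN + projTail N

end

end ZernikeDisk

/-! Everything rests on finite support. If `U₀` has no entries beyond `N`, its transform is $z^m
q(|z|^2)$ (with $|m|$ in place of $m$ if $m=-1$) with $\deg q\le N$. Squaring doubles the degree
bound, each factor $\bar z$ adds one because $\bar z z=|z|^2$, division by $z$ adds nothing, and the
tridiagonal inverse Laplacian adds one. So the nonlinear part $T$ stops at index $2N+m+1$, or $2N+1$
for $m=-1$ (`nonlinearPart_eq_zero`).

Degrees bound coefficient indices because $\mathcal Q_n^{0,m}$ is orthogonal to $z^m|z|^{2i}$ for
$i<n$ (`IsRadialPoly.coeffs_eq_zero`). Jacobi polynomials are given here by a recurrence, so their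
coefficients are first found in closed form (`jacobi_comp`); orthogonality then says that an $n$-th
finite difference of a polynomial of degree below $n$ vanishes (`sum_radialCoeff_div_eq_zero`).

Finally $AF=A^N(U_0+\pi^NT)+(T-\pi^NT)$. The two summands have disjoint supports, so their $\ell^1$
norms add. -/

namespace ZernikeDisk

noncomputable section

/-! ### Closed form of the shifted Jacobi polynomials -/

/-- The coefficient of `t ^ j` in `P_n^{0,m}(2t - 1)`. -/
def radialCoeff (m n j : ℕ) : ℝ :=
  (-1) ^ (n + j) * (n.choose j * (n + m + j).choose n)

theorem radialCoeff_eq_zero {m n j : ℕ} (h : n < j) : radialCoeff m n j = 0 := by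
  simp [radialCoeff, Nat.choose_eq_zero_of_lt h]

/-- With $n=j+d$ the binomials become a quotient of factorials without natural subtraction, so the
recurrences below reduce to rational identities. -/
theorem radialCoeff_add (m j d : ℕ) :
    radialCoeff m (j + d) j =
      (-1) ^ d * ((2 * j + d + m).factorial / (j.factorial * d.factorial * (m + j).factorial)) := by
  have h1 := Nat.add_choose_mul_factorial_mul_factorial j d
  have h2 := Nat.add_choose_mul_factorial_mul_factorial (j + d) (m + j)
  have e : j + d + (m + j) = j + d + m + j := by ring
  have e' : 2 * j + d + m = j + d + m + j := by ring
  rw [e] at h2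
  rw [e', radialCoeff, ← h2, show j + d + j = d + 2 * j by ring, pow_add, pow_mul]
  have h1' : ((j + d).choose j : ℝ) = (j + d).factorial / (j.factorial * d.factorial) := by
    rw [← h1, Nat.choose_symm_add]; push_cast; field_simp
  rw [h1']; push_cast
  rw [Nat.choose_symm_of_eq_add (show j + d + m + j = j + d + (m + j) by ring)]
  field_simp
  norm_num

/-- This is the coefficient of $t^{j+1}$ in the three-term recurrence at $x=2t-1$, with denominators
cleared. The cases record which of the terms lie beyond the degree and vanish. -/
theorem radialCoeff_succ_succ (m n j : ℕ) :
    2 * ((n : ℝ) + 2) * (n + m + 2) * (2 * n + m + 2) * radialCoeff m (n + 2) (j + 1) =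
      2 * ((2 * n + m + 3) * (2 * n + m + 4) * (2 * n + m + 2)) * radialCoeff m (n + 1) j
      - ((2 * n + m + 3) * (2 * n + m + 4) * (2 * n + m + 2) + m ^ 2 * (2 * n + m + 3))
          * radialCoeff m (n + 1) (j + 1)
      - 2 * ((n + 1) * (n + m + 1) * (2 * n + m + 4)) * radialCoeff m n (j + 1) := by
  rcases lt_trichotomy n (j + 1) with h | h | h
  · rcases lt_trichotomy (n + 1) (j + 1) with h' | h' | h'
    · rw [radialCoeff_eq_zero (n := n) (by omega), radialCoeff_eq_zero (n := n + 1) (j := j + 1) (by omega)]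
      rcases (show n + 1 = j ∨ n + 1 < j by omega) with rfl | h''
      · have a := radialCoeff_add m (n + 2) 0
        have b := radialCoeff_add m (n + 1) 0
        simp only [add_zero] at a b
        rw [show n + 1 + 1 = n + 2 by ring, a, b,
          show 2 * (n + 2) + m = (2 * (n + 1) + m + 1) + 1 by ring,
          show m + (n + 2) = m + (n + 1) + 1 by ring]
        simp only [Nat.factorial_succ]
        push_cast
        field_simp
        ring
      · rw [radialCoeff_eq_zero (n := n + 2) (by omega), radialCoeff_eq_zero (n := n + 1) (by omega)]
        ring
    · obtain rfl : n = j := by omega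
      rw [radialCoeff_eq_zero (n := n) (by omega)]
      have a := radialCoeff_add m (n + 1) 1
      have b := radialCoeff_add m n 1
      have c := radialCoeff_add m (n + 1) 0
      simp only [add_zero] at c
      rw [show n + 2 = n + 1 + 1 by ring, a, b, c,
        show 2 * (n + 1) + 1 + m = (2 * n + 1 + m + 1) + 1 by ring,
        show 2 * (n + 1) + m = (2 * n + 1 + m + 1) by ring,
        show m + (n + 1) = m + n + 1 by ring]
      simp only [Nat.factorial_succ]
      push_cast
      field_simp
      ring
    · omega
  · subst h
    have a := radialCoeff_add m (j + 1) 2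
    have b := radialCoeff_add m j 2
    have c := radialCoeff_add m (j + 1) 1
    have d := radialCoeff_add m (j + 1) 0
    simp only [add_zero] at d
    rw [show j + 1 + 1 = j + 2 by ring] at c ⊢
    rw [a, b, c, d,
      show 2 * (j + 1) + 2 + m = (2 * j + 2 + m + 1) + 1 by ring,
      show 2 * (j + 1) + 1 + m = (2 * j + 2 + m + 1) by ring,
      show 2 * (j + 1) + m = (2 * j + 2 + m) by ring,
      show m + (j + 1) = m + j + 1 by ring]
    simp only [Nat.factorial_succ]
    push_cast
    field_simp
    ring
  · obtain ⟨d, rfl⟩ : ∃ d, n = j + 1 + d + 1 := ⟨n - (j + 2), by omega⟩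
    have a := radialCoeff_add m (j + 1) (d + 3)
    have b := radialCoeff_add m j (d + 3)
    have c := radialCoeff_add m (j + 1) (d + 2)
    have e := radialCoeff_add m (j + 1) (d + 1)
    rw [show j + 1 + (d + 3) = j + 1 + d + 1 + 2 by ring,
      show 2 * (j + 1) + (d + 3) + m = (2 * j + d + m + 4) + 1 by ring,
      show m + (j + 1) = m + j + 1 by ring] at a
    rw [show j + (d + 3) = j + 1 + d + 1 + 1 by ring,
      show 2 * j + (d + 3) + m = (2 * j + d + m + 3) by ring] at b
    rw [show j + 1 + (d + 2) = j + 1 + d + 1 + 1 by ring,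
      show 2 * (j + 1) + (d + 2) + m = (2 * j + d + m + 3) + 1 by ring,
      show m + (j + 1) = m + j + 1 by ring] at c
    rw [show j + 1 + (d + 1) = j + 1 + d + 1 by ring,
      show 2 * (j + 1) + (d + 1) + m = (2 * j + d + m + 3) by ring,
      show m + (j + 1) = m + j + 1 by ring] at e
    rw [a, b, c, e]
    simp only [Nat.factorial_succ, pow_succ]
    push_cast
    field_simp
    ring

theorem radialCoeff_succ_succ_zero (m n : ℕ) :
    2 * ((n : ℝ) + 2) * (n + m + 2) * (2 * n + m + 2) * radialCoeff m (n + 2) 0 =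
      - ((2 * n + m + 3) * (2 * n + m + 4) * (2 * n + m + 2) + m ^ 2 * (2 * n + m + 3))
          * radialCoeff m (n + 1) 0
      - 2 * ((n + 1) * (n + m + 1) * (2 * n + m + 4)) * radialCoeff m n 0 := by
  have a := radialCoeff_add m 0 (n + 2)
  have b := radialCoeff_add m 0 (n + 1)
  have c := radialCoeff_add m 0 n
  simp only [zero_add, mul_zero, add_zero] at a b c
  rw [show n + 2 + m = n + m + 1 + 1 by ring] at a
  rw [show n + 1 + m = n + m + 1 by ring] at b
  rw [a, b, c]
  simp only [Nat.factorial_succ, pow_succ]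
  push_cast
  field_simp
  ring

/-- The polynomial `P_n^{0,m}(2t - 1)` in `t`. -/
def shiftedJacobi (m n : ℕ) : ℝ[X] :=
  ∑ j ∈ Finset.range (n + 1), monomial j (radialCoeff m n j)

theorem coeff_shiftedJacobi (m n j : ℕ) : (shiftedJacobi m n).coeff j = radialCoeff m n j := by
  simp only [shiftedJacobi, finsetSum_coeff, coeff_monomial, Finset.sum_ite_eq', Finset.mem_range]
  split_ifs with h
  · rfl
  · exact (radialCoeff_eq_zero (by omega)).symm

theorem shiftedJacobi_succ_succ (m n : ℕ) (a b c : ℝ)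
    (ha : a = (2 * n + m + 3) * (2 * n + m + 4) / (2 * (n + 2) * (n + m + 2)))
    (hb : b = m ^ 2 * (2 * n + m + 3) / (2 * (n + 2) * (n + m + 2) * (2 * n + m + 2)))
    (hc : c = (n + 1) * (n + m + 1) * (2 * n + m + 4) / ((n + 2) * (n + m + 2) * (2 * n + m + 2))) :
    shiftedJacobi m (n + 2) =
      (C a * (2 * X - 1) - C b) * shiftedJacobi m (n + 1) - C c * shiftedJacobi m n := by
  have e : (C a * (2 * X - 1) - C b) * shiftedJacobi m (n + 1) - C c * shiftedJacobi m n =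
      C (2 * a) * (X * shiftedJacobi m (n + 1)) - C (a + b) * shiftedJacobi m (n + 1)
        - C c * shiftedJacobi m n := by
    simp only [map_mul, map_add, map_ofNat]; ring
  rw [e]
  have h1 : (n : ℝ) + 2 ≠ 0 := by positivity
  have h2 : (n : ℝ) + m + 2 ≠ 0 := by positivity
  have h3 : 2 * (n : ℝ) + m + 2 ≠ 0 := by positivity
  ext j
  rcases j with _ | j
  · simp only [coeff_sub, coeff_C_mul, coeff_shiftedJacobi, coeff_X_mul_zero]
    have := radialCoeff_succ_succ_zero m n
    rw [ha, hb, hc]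
    field_simp
    linear_combination this
  · simp only [coeff_sub, coeff_C_mul, coeff_shiftedJacobi, coeff_X_mul]
    have := radialCoeff_succ_succ m n j
    rw [ha, hb, hc]
    field_simp
    linear_combination this

theorem jacobi_comp (m n : ℕ) : (jacobi 0 m n).comp (2 * X - 1) = shiftedJacobi m n := by
  induction n using Nat.twoStepInduction with
  | zero => simp [jacobi, shiftedJacobi, radialCoeff]
  | one =>
    simp only [jacobi, shiftedJacobi, radialCoeff, Finset.sum_range_succ, Finset.sum_range_zero]
    apply Polynomial.funext
    intro t
    simp
    ring
  | more n ih1 ih2 =>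
    simp only [jacobi, sub_comp, mul_comp, C_comp, X_comp, Nat.cast_zero, ih1, ih2]
    refine (shiftedJacobi_succ_succ m n _ _ _ ?_ ?_ ?_).symm <;> congr 1 <;> ring

theorem jacobi_eval (m n : ℕ) (t : ℝ) :
    (jacobi 0 m n).eval (2 * t - 1) = ∑ j ∈ Finset.range (n + 1), radialCoeff m n j * t ^ j := by
  have h := congrArg (eval t) (jacobi_comp m n)
  simpa [eval_comp, shiftedJacobi, eval_finsetSum] using h

/-! ### Orthogonality to lower powers -/

theorem sum_radialCoeff_div_eq_zero (m : ℕ) {n i : ℕ} (hi : i < n) :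
    ∑ j ∈ Finset.range (n + 1), radialCoeff m n j / ((m + i + j : ℕ) + 1) = 0 := by
  -- Since $n!\binom{n+m+j}{n}=\prod_{k<n}(m+j+1+k)$, the factor $k=i$ cancels the denominator. What
  -- remains is `P`, of degree $n-1$ in $j$, and the alternating binomial sum is its $n$-th forward
  -- difference at $0$.
  let P : ℝ[X] := ∏ k ∈ (Finset.range n).erase i, (X + C ((m : ℝ) + 1 + k))
  have hmem : i ∈ Finset.range n := Finset.mem_range.2 hi
  have hP : P.natDegree < n := by
    rw [natDegree_prod_of_monic _ _ fun k _ => monic_X_add_C _]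
    simp only [natDegree_X_add_C, Finset.sum_const, smul_eq_mul, mul_one,
      Finset.card_erase_of_mem hmem, Finset.card_range]
    omega
  have hchoose (j : ℕ) : (n.factorial : ℝ) * (n + m + j).choose n =
      P.eval (j : ℝ) * ((m + i + j : ℕ) + 1) := by
    have h : ((m + j + 1).ascFactorial n : ℝ) = (n.factorial : ℝ) * (n + m + j).choose n := by
      rw [Nat.ascFactorial_eq_factorial_mul_choose, show m + j + n = n + m + j by ring]
      push_cast; rfl
    rw [← h, Nat.ascFactorial_eq_prod_range, ← Finset.prod_erase_mul _ _ hmem, eval_prod]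
    push_cast
    congr 1
    · refine Finset.prod_congr rfl fun k _ => ?_
      simp only [eval_add, eval_X, eval_C]
      ring
    · ring
  have hdiff := congrFun (Polynomial.fwdDiff_iter_eq_zero_of_degree_lt hP) 0
  rw [fwdDiff_iter_eq_sum_shift] at hdiff
  have hn : (n.factorial : ℝ) ≠ 0 := by positivity
  rw [← mul_right_inj' hn, mul_zero, Finset.mul_sum]
  refine Eq.trans (Finset.sum_congr rfl fun j hj => ?_) hdiff
  have hj' : j ≤ n := by simpa [Nat.lt_succ_iff] using hj
  have hpow : (-1 : ℝ) ^ (n + j) = (-1) ^ (n - j) := by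
    obtain ⟨d, rfl⟩ := Nat.exists_eq_add_of_le hj'
    rw [show j + d + j = d + 2 * j by ring, pow_add, pow_mul, Nat.add_sub_cancel_left]
    norm_num
  have hne : ((m + i + j : ℕ) : ℝ) + 1 ≠ 0 := by positivity
  rw [radialCoeff, hpow, ← mul_div_assoc, div_eq_iff hne, zsmul_eq_mul]
  simp only [zero_add, nsmul_eq_mul, mul_one]
  have h := hchoose j
  push_cast at h ⊢
  linear_combination ((-1 : ℝ) ^ (n - j) * (n.choose j : ℝ)) * h

/-- Polar coordinates reduce this to $\int_0^1 y^{2s+1}\,dy$. The constant is the area of the disk;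
its value is irrelevant because only vanishing integrals are used. -/
theorem integral_disk_norm_sq_pow :
    ∃ c : ℝ, ∀ s : ℕ, ∫ z in Metric.closedBall (0 : ℂ) 1, (‖z‖ ^ 2) ^ s = c / (s + 1) := by
  refine ⟨(volume : Measure ℂ).real (Metric.ball 0 1), fun s => ?_⟩
  have h := integral_fun_norm_addHaar (volume : Measure ℂ)
    (Set.indicator (Set.Iic (1 : ℝ)) fun y => (y ^ 2) ^ s)
  have e : (fun z : ℂ => Set.indicator (Set.Iic (1 : ℝ)) (fun y => (y ^ 2) ^ s) ‖z‖) =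
      (Metric.closedBall (0 : ℂ) 1).indicator fun z => (‖z‖ ^ 2) ^ s := by
    funext z
    by_cases hz : ‖z‖ ≤ 1
    · rw [Set.indicator_of_mem (Set.mem_Iic.2 hz),
        Set.indicator_of_mem (mem_closedBall_zero_iff.2 hz)]
    · rw [Set.indicator_of_notMem (mt Set.mem_Iic.1 hz),
        Set.indicator_of_notMem (mt mem_closedBall_zero_iff.1 hz)]
  rw [e, integral_indicator measurableSet_closedBall] at h
  rw [h]
  have e2 : (fun y : ℝ => y ^ (Module.finrank ℝ ℂ - 1) •
      (Set.Iic (1 : ℝ)).indicator (fun y => (y ^ 2) ^ s) y) =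
      (Set.Iic (1 : ℝ)).indicator fun y => y ^ (2 * s + 1) := by
    funext y
    by_cases hy : y ≤ 1
    · simp [hy, Complex.finrank_real_complex]
      ring
    · simp [hy]
  rw [e2, setIntegral_indicator measurableSet_Iic, Set.Ioi_inter_Iic,
    ← intervalIntegral.integral_of_le zero_le_one, integral_pow]
  simp only [Complex.finrank_real_complex, nsmul_eq_mul, smul_eq_mul]
  push_cast
  have : (s : ℝ) + 1 ≠ 0 := by positivity
  have : 2 * (s : ℝ) + 1 + 1 ≠ 0 := by positivity
  field_simp
  simp
  ring

theorem zernike_natCast (m n : ℕ) (z : ℂ) :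
    zernike 0 m n z = z ^ m * ((jacobi 0 m n).eval (2 * ‖z‖ ^ 2 - 1) : ℝ) := by
  have h : z ^ m = (‖z‖ : ℂ) ^ m * Complex.exp (Complex.I * m * z.arg) := by
    conv_lhs => rw [← Complex.norm_mul_exp_arg_mul_I z]
    rw [mul_pow, ← Complex.exp_nat_mul]
    congr 2
    ring
  rw [zernike, radialZernike, h, Int.natAbs_natCast]
  push_cast
  ring

theorem integrableOn_disk {E : Type*} [NormedAddCommGroup E] {f : ℂ → E} (hf : Continuous f) :
    IntegrableOn f (Metric.closedBall (0 : ℂ) 1) :=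
  hf.continuousOn.integrableOn_compact (isCompact_closedBall _ _)

theorem integral_disk_norm_mul_jacobi_eq_zero (m : ℕ) {n i : ℕ} (hi : i < n) :
    ∫ z in Metric.closedBall (0 : ℂ) 1,
      (‖z‖ ^ 2) ^ (m + i) * (jacobi 0 m n).eval (2 * ‖z‖ ^ 2 - 1) = 0 := by
  obtain ⟨c, hc⟩ := integral_disk_norm_sq_pow
  have h (z : ℂ) : (‖z‖ ^ 2) ^ (m + i) * (jacobi 0 m n).eval (2 * ‖z‖ ^ 2 - 1) =
      ∑ j ∈ Finset.range (n + 1), radialCoeff m n j * (‖z‖ ^ 2) ^ (m + i + j) := by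
    rw [jacobi_eval, Finset.mul_sum]
    exact Finset.sum_congr rfl fun j _ => by ring
  simp only [h]
  rw [integral_finsetSum _ fun j _ => integrableOn_disk (by fun_prop)]
  simp only [integral_const_mul, hc]
  have := congrArg (c * ·) (sum_radialCoeff_div_eq_zero m hi)
  simp only [mul_zero, Finset.mul_sum] at this
  rw [← this]
  exact Finset.sum_congr rfl fun j _ => by ring

/-! ### Functions of one wave number, polynomial in $|z|^2$ -/

/-- `u` is `z ^ m` times a polynomial of degree at most `M` in `|z|²`. -/
def IsRadialPoly (m M : ℕ) (u : ℂ → ℂ) : Prop :=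
  ∃ q : ℂ[X], q.natDegree ≤ M ∧ ∀ z, u z = z ^ m * q.eval ((‖z‖ : ℂ) ^ 2)

/-- The angular factors cancel through $z^m\bar z^m=|z|^{2m}$, leaving the radial integrals already
shown to vanish. Only the numerator of the coefficient matters. -/
theorem IsRadialPoly.coeffs_eq_zero {m M : ℕ} {u : ℂ → ℂ} (hu : IsRadialPoly m M u) {n : ℕ}
    (hn : M < n) : coeffs m u n = 0 := by
  obtain ⟨q, hq, hu⟩ := hu
  rw [coeffs, div_eq_zero_iff]
  left
  have h (z : ℂ) : u z * conj (zernike 0 m n z) = ∑ i ∈ Finset.range (M + 1), q.coeff i *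
      (((‖z‖ ^ 2) ^ (m + i) * (jacobi 0 m n).eval (2 * ‖z‖ ^ 2 - 1) : ℝ) : ℂ) := by
    rw [hu, zernike_natCast, map_mul, Complex.conj_ofReal, map_pow,
      eval_eq_sum_range' (Nat.lt_succ_of_le hq)]
    have hz : z ^ m * conj z ^ m = ((‖z‖ : ℂ) ^ 2) ^ m := by
      rw [← mul_pow, Complex.mul_conj']
    calc _ = (z ^ m * conj z ^ m) * (∑ i ∈ Finset.range (M + 1), q.coeff i * ((‖z‖ : ℂ) ^ 2) ^ i)
          * ((jacobi 0 m n).eval (2 * ‖z‖ ^ 2 - 1) : ℝ) := by ring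
      _ = _ := by
        rw [hz, Finset.mul_sum, Finset.sum_mul]
        refine Finset.sum_congr rfl fun i _ => ?_
        push_cast
        ring
  simp only [h]
  have hcont : Continuous fun z : ℂ => (jacobi 0 m n).eval (2 * ‖z‖ ^ 2 - 1) :=
    (jacobi 0 m n).continuous.comp (by fun_prop)
  rw [integral_finsetSum _ fun i _ => integrableOn_disk (by fun_prop)]
  refine Finset.sum_eq_zero fun i hi => ?_
  have hin : i < n := lt_of_lt_of_le (Finset.mem_range.1 hi) hn
  rw [integral_const_mul, integral_complex_ofReal, integral_disk_norm_mul_jacobi_eq_zero m hin]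
  simp

/-- Finite support collapses the series to a finite sum, so no convergence question arises. -/
theorem isRadialPoly_transform (m : ℕ) {M : ℕ} {a : ℕ → ℂ} (ha : ∀ n, M < n → a n = 0) :
    IsRadialPoly m M (transform m a) := by
  refine ⟨∑ n ∈ Finset.range (M + 1), C (a n) * (shiftedJacobi m n).map Complex.ofRealHom, ?_, ?_⟩
  · refine natDegree_sum_le_of_forall_le _ _ fun n hn => ?_
    refine (natDegree_C_mul_le _ _).trans (natDegree_map_le.trans ?_)
    refine natDegree_le_iff_coeff_eq_zero.2 fun j hj => ?_
    rw [coeff_shiftedJacobi]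
    exact radialCoeff_eq_zero (by have := Finset.mem_range.1 hn; omega)
  · intro z
    rw [transform, tsum_eq_sum (s := Finset.range (M + 1)), eval_finsetSum, Finset.mul_sum]
    · refine Finset.sum_congr rfl fun n _ => ?_
      rw [zernike_natCast, eval_mul, eval_C, ← jacobi_comp, eval_map, ← Complex.ofReal_pow]
      have := eval₂_at_apply (p := (jacobi 0 m n).comp (2 * X - 1)) Complex.ofRealHom (‖z‖ ^ 2)
      rw [Complex.ofRealHom_eq_coe] at this
      rw [this]
      simp [eval_comp]
      ring
    · intro n hn
      rw [ha n (by simpa using hn), zero_mul]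

theorem IsRadialPoly.mul {m₁ m₂ M₁ M₂ : ℕ} {u v : ℂ → ℂ} (hu : IsRadialPoly m₁ M₁ u)
    (hv : IsRadialPoly m₂ M₂ v) : IsRadialPoly (m₁ + m₂) (M₁ + M₂) fun z => u z * v z := by
  obtain ⟨p, hp, hu⟩ := hu
  obtain ⟨q, hq, hv⟩ := hv
  refine ⟨p * q, natDegree_mul_le.trans (add_le_add hp hq), fun z => ?_⟩
  simp only [hu, hv, eval_mul]
  ring

theorem IsRadialPoly.conj_mul {m M : ℕ} {u : ℂ → ℂ} (hu : IsRadialPoly (m + 1) M u) :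
    IsRadialPoly m (M + 1) fun z => conj z * u z := by
  obtain ⟨p, hp, hu⟩ := hu
  refine ⟨p * X, natDegree_mul_le.trans (add_le_add hp natDegree_X_le), fun z => ?_⟩
  simp only [hu, eval_mul, eval_X, ← Complex.conj_mul']
  ring

theorem IsRadialPoly.inv_mul {m M : ℕ} {u : ℂ → ℂ} (hu : IsRadialPoly (m + 2) M u) :
    IsRadialPoly (m + 1) M fun z => z⁻¹ * u z := by
  obtain ⟨p, hp, hu⟩ := hu
  refine ⟨p, hp, fun z => ?_⟩
  simp only [hu]
  -- At the origin `0⁻¹ = 0` agrees with the polynomial form because a positive power of $z$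
  -- survives the division.
  rcases eq_or_ne z 0 with rfl | hz
  · simp
  · field_simp
    ring

/-! ### Growth of supports under the coefficient operations -/

theorem conv_eq_zero (m₁ m₂ : ℕ) {M₁ M₂ : ℕ} {a b : ℕ → ℂ} (ha : ∀ n, M₁ < n → a n = 0)
    (hb : ∀ n, M₂ < n → b n = 0) {n : ℕ} (hn : M₁ + M₂ < n) : conv m₁ m₂ a b n = 0 := by
  rw [conv, ← Nat.cast_add]
  exact ((isRadialPoly_transform m₁ ha).mul (isRadialPoly_transform m₂ hb)).coeffs_eq_zero hn

theorem rMinus_eq_zero (m : ℕ) {M : ℕ} {a : ℕ → ℂ} (ha : ∀ n, M < n → a n = 0) {n : ℕ}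
    (hn : M + 1 < n) : rMinus (m + 1 : ℕ) a n = 0 := by
  rw [rMinus, show ((m + 1 : ℕ) : ℤ) - 1 = (m : ℕ) by push_cast; ring]
  exact (isRadialPoly_transform (m + 1) ha).conj_mul.coeffs_eq_zero hn

theorem rMinusPow_eq_zero (j m : ℕ) {M : ℕ} {a : ℕ → ℂ} (ha : ∀ n, M < n → a n = 0) {n : ℕ}
    (hn : M + j < n) : rMinusPow j (m + j : ℕ) a n = 0 := by
  induction j generalizing M a with
  | zero => exact ha n hn
  | succ j ih =>
    rw [rMinusPow, show ((m + (j + 1) : ℕ) : ℤ) - 1 = (m + j : ℕ) by push_cast; ring]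
    exact ih (M := M + 1) (fun k hk => rMinus_eq_zero (m + j) ha hk) (by omega)

theorem rPlusInv_eq_zero {M : ℕ} {a : ℕ → ℂ} (ha : ∀ n, M < n → a n = 0) {n : ℕ}
    (hn : M < n) : rPlusInv a n = 0 := by
  exact (isRadialPoly_transform 2 ha).inv_mul (m := 0).coeffs_eq_zero hn

theorem invLaplacianBasis_eq_zero (m : ℕ) {n i : ℕ} (h : n + 1 < i) :
    invLaplacianBasis m n i = 0 := by
  rcases n with _ | n
  · simp [invLaplacianBasis, show i ≠ 1 by omega, show i ≠ 0 by omega]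
  · simp [invLaplacianBasis, show i ≠ n + 2 by omega, show i ≠ n + 1 by omega,
      show i ≠ n by omega]

theorem invLaplacian_eq_zero (m : ℕ) {M : ℕ} {a : ℕ → ℂ} (ha : ∀ n, M < n → a n = 0) {i : ℕ}
    (hi : M + 1 < i) : invLaplacian m a i = 0 := by
  refine Finset.sum_eq_zero fun n _ => ?_
  rcases lt_or_ge M n with h | h
  · rw [ha n h, zero_mul]
  · rw [invLaplacianBasis_eq_zero m (by omega), mul_zero]

/-- The bound adds up as $N+N$ from the product, $m$ from $(R^-)^m$ (nothing from division by $z$),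
and $1$ from the inverse Laplacian. -/
theorem nonlinearPart_eq_zero (m : ℤ) (hm : -1 ≤ m) {N : ℕ} {U : ℕ → ℂ}
    (hU : ∀ n, N < n → U n = 0) {i : ℕ}
    (hi : (if m = -1 then 2 * N + 1 else 2 * N + m.toNat + 1) < i) :
    nonlinearPart m U i = 0 := by
  rw [nonlinearPart]
  split_ifs at hi ⊢ with h
  · refine invLaplacian_eq_zero 1 (M := 2 * N) (fun n hn => ?_) hi
    refine rPlusInv_eq_zero (M := 2 * N) (fun k hk => ?_) hn
    exact conv_eq_zero 1 1 hU hU (by omega)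
  · lift m to ℕ using by omega
    rw [Int.toNat_natCast] at hi ⊢
    refine invLaplacian_eq_zero m (M := 2 * N + m) (fun n hn => ?_) hi
    refine rMinusPow_eq_zero m m (M := 2 * N) (fun k hk => ?_) hn
    exact conv_eq_zero m m hU hU (by omega)

/-! ### Norms in $\ell^1$ and the approximate inverse -/

theorem memℓp_of_eq_zero {M : ℕ} {a : ℕ → ℂ} (ha : ∀ n, M < n → a n = 0) : Memℓp a 1 := by
  refine memℓp_gen (summable_of_ne_finset_zero (s := Finset.range (M + 1)) fun n hn => ?_)
  rw [ha n (by simpa using hn)]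
  simp

theorem proj_apply (N : ℕ) (v : V) (n : ℕ) :
    (proj N v : ℕ → ℂ) n = if n ≤ N then (v : ℕ → ℂ) n else 0 := rfl

theorem norm_add_of_disjoint (v w : V) (h : ∀ n, (v : ℕ → ℂ) n = 0 ∨ (w : ℕ → ℂ) n = 0) :
    ‖v + w‖ = ‖v‖ + ‖w‖ := by
  have hs (x : V) : HasSum (fun n => ‖(x : ℕ → ℂ) n‖) ‖x‖ := by
    simpa using lp.hasSum_norm (p := 1) (by norm_num) x
  refine (hs (v + w)).unique ?_
  convert (hs v).add (hs w) using 2 with n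
  rcases h n with h | h <;> simp [h]

/-- $A^N$ sees only $\pi^N$ of its argument, while $\pi^\infty$ kills $U=\pi^NU$ and so acts on $T$
alone. -/
theorem approxInverse_apply (N : ℕ) (AN : V →L[ℂ] V) (hAN : AN = (proj N).comp (AN.comp (proj N)))
    (U T : V) (hU : U = proj N U) :
    approxInverse N AN (U + T) = AN (U + proj N T) + (T - proj N T) := by
  have hA (x : V) : AN (proj N x) = AN x := by
    have hp : proj N (proj N x) = proj N x := by
      ext n
      simp only [proj_apply]
      split_ifs <;> rfl
    rw [hAN]
    simp only [ContinuousLinearMap.comp_apply, hp]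
  have h : AN (U + proj N T) = AN (U + T) := by rw [map_add, hA, map_add]
  rw [h, approxInverse, projTail]
  simp only [add_apply, sub_apply,
    ContinuousLinearMap.id_apply, map_add (proj N), ← hU]
  abel

end

end ZernikeDisk

theorem mainTheorem7 (m : ℤ) (hm : -1 ≤ m) (N : ℕ)
    (U₀ : ZernikeDisk.V) (hU₀ : U₀ = ZernikeDisk.proj N U₀)
    (AN : ZernikeDisk.V →L[ℂ] ZernikeDisk.V)
    (hAN : AN = (ZernikeDisk.proj N).comp (AN.comp (ZernikeDisk.proj N))) :
    ∃ (hT : Memℓp (ZernikeDisk.nonlinearPart m U₀) 1) (hF : Memℓp (ZernikeDisk.zeroMap m U₀) 1),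
      let T : ZernikeDisk.V := ⟨ZernikeDisk.nonlinearPart m U₀, hT⟩
      let F : ZernikeDisk.V := ⟨ZernikeDisk.zeroMap m U₀, hF⟩
      let A : ZernikeDisk.V →L[ℂ] ZernikeDisk.V := ZernikeDisk.approxInverse N AN
      let K : ℕ := if m = -1 then 2 * N + 1 else 2 * N + m.toNat + 1
      let bound : ℝ := ‖AN (U₀ + ZernikeDisk.proj N T)‖
        + ‖(ZernikeDisk.proj K - ZernikeDisk.proj N) T‖
      ‖A F‖ = bound ∧ ∀ Y₀ : ℝ, bound ≤ Y₀ → ‖A F‖ ≤ Y₀ := by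
  have hU (n : ℕ) (hn : N < n) : (U₀ : ℕ → ℂ) n = 0 := by
    rw [hU₀, ZernikeDisk.proj_apply, if_neg hn.not_ge]
  have hsupp := fun i => ZernikeDisk.nonlinearPart_eq_zero m hm hU (i := i)
  have hT : Memℓp (ZernikeDisk.nonlinearPart m U₀) 1 := ZernikeDisk.memℓp_of_eq_zero hsupp
  refine ⟨hT, (lp.memℓp U₀).add hT, ?_⟩
  intro T F A K bound
  suffices h : ‖A F‖ = bound from ⟨h, fun Y hY => h.trans_le hY⟩
  -- The support bound makes $\pi^K$ act trivially on $T$, so the whole tail of $T$ is the finite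
  -- block in the bound.
  have hK : ZernikeDisk.proj K T = T := by
    ext n
    rw [ZernikeDisk.proj_apply]
    split_ifs with hn
    · rfl
    · exact (hsupp n (not_le.1 hn)).symm
  have hAF : A F = AN (U₀ + ZernikeDisk.proj N T) + (T - ZernikeDisk.proj N T) :=
    ZernikeDisk.approxInverse_apply N AN hAN U₀ T hU₀
  change ‖A F‖ = ‖_‖ + ‖_‖
  rw [hAF, sub_apply, hK]
  -- The tail vanishes at indices up to $N$; the range of $A^N=\pi^NA^N\pi^N$ vanishes beyond $N$.
  refine ZernikeDisk.norm_add_of_disjoint _ _ fun n => ?_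
  rcases le_or_gt n N with hn | hn
  · right
    rw [lp.coeFn_sub, Pi.sub_apply, ZernikeDisk.proj_apply, if_pos hn, sub_self]
  · left
    rw [hAN, ContinuousLinearMap.comp_apply, ZernikeDisk.proj_apply, if_neg hn.not_ge]
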